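/- Work with finite-dimensional bipartite systems $AB$, with partial transpose $T_B$ in the computational basis of $B$. A PPT operation is a completely positive trace-preserving map $\Lambda$ between bipartite systems such that $T_B\circ\Lambda\circ T_B$ is completely positive. Let $|\Phi_d\rangle=\frac1{\sqrt d}\sum_{i<d}|ii\rangle$, $\Phi_d=|\Phi_d\rangle\langle\Phi_d|$ and $\Phi=\Phi_2$ (the Bell pair). The exact PPT entanglement cost $E_c^0(\rho)$ is the infimum of all real $r$ such that for every $\delta>0$ there are $m\ge 0$, $n\ge1$ and a PPT operation $\Lambda$ with $\Lambda(\Phi^{\otimes m})=\rho^{\otimes n}$ and $m/n\le r+\delta$. The catalytic exact PPT entanglement cost $E_{c,c}^0(\rho)$ is the infimum of all real $r$ such that for every $\delta>0$ there are $m\ge 0$, $n\ge1$, a finite-dimensional bipartite catalyst $C$ in a state $\tau_C$ and a PPT operation $\Lambda$ with $\mathrm{Tr}_C\,\Lambda(\Phi_S^{\otimes m}\otimes\tau_C)=\rho_S^{\otimes n}$, $\mathrm{Tr}_S\,\Lambda(\Phi_S^{\otimes m}\otimes\tau_C)=\tau_C$ and $m/n\le r+\delta$. The logarithmic negativity is $L_N(\rho)=\log_2\|T_B(\rho)\|_1$,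 and $\rho$ has positive binegativity if $T_B(|T_B(\rho)|)\ge0$. Let $d\ge1$ and $$\rho=\tfrac12\Phi_d+\tfrac12\tfrac{\mathbf 1}{d^2},\qquad \mu=\tfrac12\Big(\Phi_d\otimes\tfrac{\mathbf 1}{d^2}+\tfrac{\mathbf 1}{d^2}\otimes\Phi_d\Big),$$ where $\mu$ is regarded as a bipartite state between $A_1A_2$ and $B_1B_2$. Then $\rho$ is a state, and $\mu$ is a 2-copy broadcast of $\rho$ (a state both of whose marginals, on $A_1B_1$ and on $A_2B_2$, equal $\rho$). Both $\rho$ and $\mu$ have positive binegativity, and $$E_c^0(\rho)=L_N(\rho)=E_c^0(\mu)=L_N(\mu)=\log_2\Big(\frac{d^2+1}{d}\Big)-1 .$$ Moreover $$E_{c,c}^0(\rho)\le\tfrac12E_c^0(\mu),\qquad E_{c,c}^0(\rho)\le\tfrac12E_c^0(\rho),$$ and, if $d\ge2$, $\tfrac12E_c^0(\mu)<E_c^0(\rho)$; so catalysis at least halves the cost, which is strictly positive for $d\ge2$. -/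

import Mathlib

open scoped MatrixOrder ComplexOrder

namespace PPTEntanglement

noncomputable section

/-- Operators on the Hilbert space with orthonormal (computational) basis `I`. -/
abbrev Op (I : Type) : Type := Matrix I I ℂ

/-- Operators on the bipartite system `AB`, in the product basis `A × B`. -/
abbrev BiOp (A B : Type) : Type := Op (A × B)

/-- A density operator: positive semidefinite with unit trace. -/
def IsState {I : Type} [Fintype I] (ρ : Op I) : Prop :=
  ρ.PosSemidef ∧ ρ.trace = 1

/-- The partial transpose `T_B` on the computational basis of system `B`. -/
def partialTranspose (A B : Type) : BiOp A B →ₗ[ℂ] BiOp A B where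
  toFun X := Matrix.of fun x y => X (x.1, y.2) (y.1, x.2)
  map_add' _ _ := rfl
  map_smul' _ _ := rfl

/-- The map `id_k ⊗ Λ`, acting block by block. -/
def ampliation {I J : Type} (k : ℕ) (Λ : Op I →ₗ[ℂ] Op J) (X : Op (Fin k × I)) :
    Op (Fin k × J) :=
  Matrix.of fun p q => Λ (Matrix.of fun i j => X (p.1, i) (q.1, j)) p.2 q.2

/-- Complete positivity: `id_k ⊗ Λ` is positive for every `k`. -/
def IsCompletelyPositive {I J : Type} (Λ : Op I →ₗ[ℂ] Op J) : Prop :=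
  ∀ (k : ℕ) (X : Op (Fin k × I)), X.PosSemidef → (ampliation k Λ X).PosSemidef

/-- Trace preservation. -/
def IsTracePreserving {I J : Type} [Fintype I] [Fintype J] (Λ : Op I →ₗ[ℂ] Op J) : Prop :=
  ∀ X : Op I, (Λ X).trace = X.trace

/-- A PPT operation: a completely positive trace-preserving map `Λ` between bipartite systems
such that `T_B ∘ Λ ∘ T_B` is completely positive as well. -/
def IsPPTOperation {A B A' B' : Type} [Fintype A] [Fintype B] [Fintype A'] [Fintype B']
    (Λ : BiOp A B →ₗ[ℂ] BiOp A' B') : Prop :=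
  IsCompletelyPositive Λ ∧ IsTracePreserving Λ ∧
    IsCompletelyPositive (partialTranspose A' B' ∘ₗ Λ ∘ₗ partialTranspose A B)

/-- The tensor product of operators on two bipartite systems, seen as an operator on the
bipartite system whose two parties hold `A₁A₂` and `B₁B₂`. -/
def tensor {A₁ B₁ A₂ B₂ : Type} (X : BiOp A₁ B₁) (Y : BiOp A₂ B₂) : BiOp (A₁ × A₂) (B₁ × B₂) :=
  Matrix.of fun x y =>
    X (x.1.1, x.2.1) (y.1.1, y.2.1) * Y (x.1.2, x.2.2) (y.1.2, y.2.2)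

/-- The tensor power `X^{⊗ n}`, seen as an operator on the bipartite system whose two parties
hold `Aⁿ` and `Bⁿ`. -/
def tensorPower {A B : Type} (X : BiOp A B) (n : ℕ) : BiOp (Fin n → A) (Fin n → B) :=
  Matrix.of fun x y => ∏ i, X (x.1 i, x.2 i) (y.1 i, y.2 i)

/-- Partial trace over the second of two bipartite systems. -/
def traceSnd {A₁ B₁ A₂ B₂ : Type} [Fintype A₂] [Fintype B₂]
    (X : BiOp (A₁ × A₂) (B₁ × B₂)) : BiOp A₁ B₁ :=
  Matrix.of fun x y => ∑ a : A₂, ∑ b : B₂, X ((x.1, a), (x.2, b)) ((y.1, a), (y.2, b))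

/-- Partial trace over the first of two bipartite systems. -/
def traceFst {A₁ B₁ A₂ B₂ : Type} [Fintype A₁] [Fintype B₁]
    (X : BiOp (A₁ × A₂) (B₁ × B₂)) : BiOp A₂ B₂ :=
  Matrix.of fun x y => ∑ a : A₁, ∑ b : B₁, X ((a, x.1), (b, x.2)) ((a, y.1), (b, y.2))

/-- `μ` is a 2-copy broadcast of `ρ`: a state of two copies, both of whose marginals are `ρ`. -/
def IsTwoCopyBroadcast {A B : Type} [Fintype A] [Fintype B]
    (μ : BiOp (A × A) (B × B)) (ρ : BiOp A B) : Prop :=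
  IsState μ ∧ traceSnd μ = ρ ∧ traceFst μ = ρ

/-- The vector `|Φ_d⟩ = ∑_{i < d} |ii⟩ / √d`. -/
def maxEntangledVec (d : ℕ) : Fin d × Fin d → ℂ :=
  fun x => if x.1 = x.2 then ((1 / Real.sqrt d : ℝ) : ℂ) else 0

/-- The maximally entangled state `Φ_d = |Φ_d⟩⟨Φ_d|`. -/
def maxEntangled (d : ℕ) : BiOp (Fin d) (Fin d) :=
  Matrix.vecMulVec (maxEntangledVec d) (star (maxEntangledVec d))

/-- The maximally mixed state `𝟙 / d²` of two `d`-level systems. -/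
def maxMixed (d : ℕ) : BiOp (Fin d) (Fin d) :=
  (1 / (d : ℂ) ^ 2) • (1 : BiOp (Fin d) (Fin d))

/-- The Bell pair. -/
def bell : BiOp (Fin 2) (Fin 2) := maxEntangled 2

/-- The trace norm `‖X‖₁ = Tr |X|`, where `|X| = √(X† X)`. -/
def traceNorm {I : Type} [Fintype I] [DecidableEq I] (X : Op I) : ℝ :=
  (CFC.abs X).trace.re

/-- The logarithmic negativity `L_N(ρ) = log₂ ‖T_B(ρ)‖₁`. -/
def logNegativity {A B : Type} [Fintype A] [Fintype B] [DecidableEq A] [DecidableEq B]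
    (ρ : BiOp A B) : ℝ :=
  Real.logb 2 (traceNorm (partialTranspose A B ρ))

/-- Positive binegativity: `T_B(|T_B(ρ)|) ≥ 0`. -/
def HasPositiveBinegativity {A B : Type} [Fintype A] [Fintype B] [DecidableEq A] [DecidableEq B]
    (ρ : BiOp A B) : Prop :=
  (partialTranspose A B (CFC.abs (partialTranspose A B ρ))).PosSemidef

/-- The rate `r` is achievable: for any `δ > 0`, some PPT operation maps `m` Bell pairs exactly
to `n ≥ 1` copies of `ρ`, with `m / n ≤ r + δ`. -/
def IsAchievable {A B : Type} [Fintype A] [Fintype B] (ρ : BiOp A B) (r : ℝ) : Prop :=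
  ∀ δ : ℝ, 0 < δ → ∃ m n : ℕ, 0 < n ∧
    (∃ Λ : BiOp (Fin m → Fin 2) (Fin m → Fin 2) →ₗ[ℂ] BiOp (Fin n → A) (Fin n → B),
      IsPPTOperation Λ ∧ Λ (tensorPower bell m) = tensorPower ρ n) ∧
    (m : ℝ) / n ≤ r + δ

/-- The rate `r` is catalytically achievable: for any `δ > 0`, some PPT operation maps `m` Bell
pairs together with a (finite-dimensional, bipartite) catalyst in a state `τ` to a state whose
marginal on the system is exactly `n ≥ 1` copies of `ρ` and whose marginal on the catalyst is
`τ`, with `m / n ≤ r + δ`. -/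
def IsCatalyticallyAchievable {A B : Type} [Fintype A] [Fintype B]
    (ρ : BiOp A B) (r : ℝ) : Prop :=
  ∀ δ : ℝ, 0 < δ → ∃ m n : ℕ, 0 < n ∧
    (∃ (CA CB : Type) (_ : Fintype CA) (_ : Fintype CB) (τ : BiOp CA CB)
      (Λ : BiOp ((Fin m → Fin 2) × CA) ((Fin m → Fin 2) × CB) →ₗ[ℂ]
        BiOp ((Fin n → A) × CA) ((Fin n → B) × CB)),
      IsState τ ∧ IsPPTOperation Λ ∧
      traceSnd (Λ (tensor (tensorPower bell m) τ)) = tensorPower ρ n ∧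
      traceFst (Λ (tensor (tensorPower bell m) τ)) = τ) ∧
    (m : ℝ) / n ≤ r + δ

/-- The exact PPT entanglement cost `E_c^0(ρ)`: the infimum of the achievable rates
(`+∞` if there are none). -/
def exactCost {A B : Type} [Fintype A] [Fintype B] (ρ : BiOp A B) : EReal :=
  ⨅ (r : ℝ) (_ : IsAchievable ρ r), (r : EReal)

/-- The catalytic exact PPT entanglement cost `E_{c,c}^0(ρ)`: the infimum of the catalytically
achievable rates (`+∞` if there are none). -/
def catalyticExactCost {A B : Type} [Fintype A] [Fintype B] (ρ : BiOp A B) : EReal :=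
  ⨅ (r : ℝ) (_ : IsCatalyticallyAchievable ρ r), (r : EReal)

/-- The state `ρ = ½ Φ_d + ½ 𝟙/d²`. -/
def exampleState (d : ℕ) : BiOp (Fin d) (Fin d) :=
  (1 / 2 : ℂ) • maxEntangled d + (1 / 2 : ℂ) • maxMixed d

/-- The state `μ = ½ (Φ_d ⊗ 𝟙/d² + 𝟙/d² ⊗ Φ_d)`. -/
def exampleBroadcast (d : ℕ) : BiOp (Fin d × Fin d) (Fin d × Fin d) :=
  (1 / 2 : ℂ) • (tensor (maxEntangled d) (maxMixed d) + tensor (maxMixed d) (maxEntangled d))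

end

end PPTEntanglement

/-!
For a state `ρ` with positive binegativity, the exact PPT cost equals the logarithmic negativity
(`exactCost_eq_logNegativity`).

* Lower bound: `T_B ∘ Λ ∘ T_B` is positive and trace preserving, so it does not increase the trace
  norm of a Hermitian operator (`IsPPTOperation.traceNorm_partialTranspose_le`). As
  `‖T_B(Φ^{⊗ m})‖₁ = 2 ^ m` and the trace norm is multiplicative on tensor powers, `m` Bell pairs
  yield `n` copies of `ρ` only if `n L_N(ρ) ≤ m` (`logNegativity_le_of_isAchievable`).
* Upper bound: a state `σ` with positive binegativity can be prepared from `m` Bell pairs as soon as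
  `‖T_B(σ)‖₁ + 1 ≤ 2 ^ m`, by testing for `Φ^{⊗ m}` and preparing `σ` or, on failure, the state
  proportional to `T_B(|T_B(σ)|)` (`exists_isPPTOperation_of_traceNorm_add_one_le`). Positive
  binegativity passes to tensor powers because the absolute value does.

For the two states of the example everything is explicit. With `F` the swap operator,
`T_B(Φ_d) = F / d`, hence `T_B(ρ) = (1 + d F) / (2 d²)` and `T_B(μ) = (F₁ + F₂) / (2 d³)`, with
absolute values `(d + F) / (2 d²)` and `(1 + F₁ F₂) / (2 d³)`. Their traces are both
`(d² + 1) / (2 d)`, and their partial transposes are positive.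

Catalysis turns a broadcast `μ` of `ρ` into independent copies
(`IsTwoCopyBroadcast.isCatalyticallyAchievable`). With catalyst `ρ^{⊗ n}`, prepare `μ^{⊗ n}` and
exchange its second halves with the catalyst. The system then holds the first halves of `μ^{⊗ n}`
and the old catalyst, which are uncorrelated, so it is in the state `ρ^{⊗ 2n}`. The new catalyst has
the right marginal, although it is correlated with the system. Thus `2n` copies of `ρ` cost no more
than `n` copies of `μ`.
-/

namespace PPTEntanglement

/-! ### The absolute value and the trace norm -/

section TraceNorm

variable {I : Type} [Fintype I] [DecidableEq I]

theorem cfcAbs_eq_of_posSemidef {X Y : Op I} (hY : Y.PosSemidef)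
    (h : Y * Y = X.conjTranspose * X) : CFC.abs X = Y := by
  rw [CFC.abs]
  exact CFC.sqrt_unique h (Matrix.nonneg_iff_posSemidef.2 hY)

theorem posSemidef_cfcAbs (X : Op I) : (CFC.abs X).PosSemidef :=
  Matrix.nonneg_iff_posSemidef.1 (CFC.abs_nonneg X)

theorem posSemidef_cfcAbs_add_self {X : Op I} (hX : X.IsHermitian) :
    (CFC.abs X + X).PosSemidef := by
  rw [CFC.abs_add_self X hX, two_nsmul]
  exact (Matrix.nonneg_iff_posSemidef.1 (CFC.posPart_nonneg X)).add
    (Matrix.nonneg_iff_posSemidef.1 (CFC.posPart_nonneg X))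

theorem posSemidef_cfcAbs_sub_self {X : Op I} (hX : X.IsHermitian) :
    (CFC.abs X - X).PosSemidef := by
  rw [CFC.abs_sub_self X hX, two_nsmul]
  exact (Matrix.nonneg_iff_posSemidef.1 (CFC.negPart_nonneg X)).add
    (Matrix.nonneg_iff_posSemidef.1 (CFC.negPart_nonneg X))

theorem coe_traceNorm (X : Op I) : (traceNorm X : ℂ) = (CFC.abs X).trace :=
  (Complex.eq_re_of_ofReal_le (r := 0) (by simpa using (posSemidef_cfcAbs X).trace_nonneg)).symm

/-- The trace norm of a Hermitian operator is at least its trace. -/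
theorem re_trace_le_traceNorm {X : Op I} (hX : X.IsHermitian) : X.trace.re ≤ traceNorm X := by
  have h := (posSemidef_cfcAbs_sub_self hX).trace_nonneg
  rw [Matrix.trace_sub] at h
  have := (Complex.le_def.1 h).1
  simp only [Complex.zero_re, Complex.sub_re] at this
  simpa [traceNorm] using this

/-- The triangle inequality for a difference of positive operators: in an eigenbasis of `P - Q`,
each eigenvalue is a difference of nonnegative diagonal entries of `P` and `Q`. -/
theorem traceNorm_sub_le {P Q : Op I} (hP : P.PosSemidef) (hQ : Q.PosSemidef) :
    traceNorm (P - Q) ≤ P.trace.re + Q.trace.re := by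
  have hH : (P - Q).IsHermitian := hP.1.sub hQ.1
  set U : Op I := (hH.eigenvectorUnitary : Op I) with hU
  have hUU : U.conjTranspose * U = 1 := Unitary.coe_star_mul_self hH.eigenvectorUnitary
  have hUU' : U * U.conjTranspose = 1 := Unitary.coe_mul_star_self hH.eigenvectorUnitary
  set D : Op I := Matrix.diagonal (fun i => ((hH.eigenvalues i : ℝ) : ℂ)) with hD
  set E : Op I := Matrix.diagonal (fun i => ((|hH.eigenvalues i| : ℝ) : ℂ)) with hE
  have hspec : P - Q = U * D * U.conjTranspose := by
    have := hH.spectral_theorem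
    rw [Unitary.conjStarAlgAut_apply] at this
    exact this
  have hdiag : U.conjTranspose * P * U - U.conjTranspose * Q * U = D := by
    rw [← Matrix.sub_mul, ← Matrix.mul_sub, hspec]
    simp only [Matrix.mul_assoc, hUU, Matrix.mul_one]
    rw [← Matrix.mul_assoc, hUU, Matrix.one_mul]
  have hDD : E * E = D.conjTranspose * D := by
    simp only [hE, hD, Matrix.diagonal_conjTranspose, Matrix.diagonal_mul_diagonal]
    congr 1
    funext i
    simp only [Pi.star_apply, RCLike.star_def, Complex.conj_ofReal]
    exact_mod_cast abs_mul_abs_self _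
  have habs : CFC.abs (P - Q) = U * E * U.conjTranspose := by
    apply cfcAbs_eq_of_posSemidef
    · refine Matrix.PosSemidef.mul_mul_conjTranspose_same (Matrix.PosSemidef.diagonal ?_) U
      intro i
      simp
    · rw [hspec]
      simp only [Matrix.conjTranspose_mul, Matrix.conjTranspose_conjTranspose]
      have h1 : U * E * U.conjTranspose * (U * E * U.conjTranspose)
          = U * (E * (U.conjTranspose * U) * E) * U.conjTranspose := by
        simp only [Matrix.mul_assoc]
      have h2 : U * (D.conjTranspose * U.conjTranspose) * (U * D * U.conjTranspose)
          = U * (D.conjTranspose * (U.conjTranspose * U) * D) * U.conjTranspose := by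
        simp only [Matrix.mul_assoc]
      rw [h1, h2, hUU, Matrix.mul_one, Matrix.mul_one, hDD]
  have htr : ∀ X : Op I, (U.conjTranspose * X * U).trace = X.trace := fun X => by
    rw [Matrix.trace_mul_comm, ← Matrix.mul_assoc, hUU', Matrix.one_mul]
  have hP' := hP.conjTranspose_mul_mul_same U
  have hQ' := hQ.conjTranspose_mul_mul_same U
  rw [traceNorm, habs, Matrix.trace_mul_comm, ← Matrix.mul_assoc, hUU, Matrix.one_mul,
    ← htr P, ← htr Q, hE]
  simp only [Matrix.trace, Matrix.diag_apply, Matrix.diagonal_apply_eq, Complex.re_sum,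
    Complex.ofReal_re, ← Finset.sum_add_distrib]
  refine Finset.sum_le_sum fun i _ => ?_
  have hp := (Complex.le_def.1 (hP'.diag_nonneg (i := i))).1
  have hq := (Complex.le_def.1 (hQ'.diag_nonneg (i := i))).1
  have hi := congrArg Complex.re (congrFun (congrFun hdiag i) i)
  simp only [Matrix.sub_apply, Complex.sub_re, hD, Matrix.diagonal_apply_eq,
    Complex.ofReal_re] at hi
  simp only [Complex.zero_re] at hp hq
  rw [← hi, abs_le]
  constructor <;> linarith

/-- A Hermitian involution is bounded below by `-1`, since `(1 + F)² = 2 (1 + F)`. -/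
theorem posSemidef_one_add_of_involution {F : Op I} (hF : F.IsHermitian) (h : F * F = 1) :
    (1 + F).PosSemidef := by
  have key : (1 + F : Op I) = (1 / 2 : ℂ) • ((1 + F).conjTranspose * (1 + F)) := by
    rw [Matrix.conjTranspose_add, hF.eq, Matrix.conjTranspose_one, Matrix.add_mul, Matrix.mul_add,
      Matrix.mul_add, h]
    simp only [Matrix.mul_one, Matrix.one_mul]
    module
  rw [key]
  exact (Matrix.posSemidef_conjTranspose_mul_self _).smul (by simp)

theorem posSemidef_one_sub_of_involution {F : Op I} (hF : F.IsHermitian) (h : F * F = 1) :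
    (1 - F).PosSemidef := by
  rw [sub_eq_add_neg]
  exact posSemidef_one_add_of_involution hF.neg (by rw [neg_mul_neg, h])

theorem posSemidef_one_sub_of_projection {P : Op I} (hP : P.IsHermitian) (h : P * P = P) :
    (1 - P).PosSemidef := by
  have key : (1 - P : Op I) = (1 - P).conjTranspose * (1 - P) := by
    rw [Matrix.conjTranspose_sub, hP.eq, Matrix.conjTranspose_one, Matrix.sub_mul, Matrix.mul_sub,
      Matrix.mul_sub, h]
    simp
  rw [key]
  exact Matrix.posSemidef_conjTranspose_mul_self _

theorem exists_conjTranspose_mul_self {X : Op I} (hX : X.PosSemidef) :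
    ∃ Y : Op I, X = Y.conjTranspose * Y :=
  CStarAlgebra.nonneg_iff_eq_star_mul_self.1 (Matrix.nonneg_iff_posSemidef.2 hX)

end TraceNorm

/-! ### Partial transposes and tensor products -/

section Tensor

variable {A B A₁ B₁ A₂ B₂ : Type}

theorem partialTranspose_apply (X : BiOp A B) (x y : A × B) :
    partialTranspose A B X x y = X (x.1, y.2) (y.1, x.2) := rfl

theorem partialTranspose_partialTranspose (X : BiOp A B) :
    partialTranspose A B (partialTranspose A B X) = X := rfl

theorem trace_partialTranspose [Fintype A] [Fintype B] (X : BiOp A B) :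
    (partialTranspose A B X).trace = X.trace := rfl

theorem partialTranspose_one [DecidableEq A] [DecidableEq B] :
    partialTranspose A B (1 : BiOp A B) = 1 := by
  ext x y
  simp only [partialTranspose_apply, Matrix.one_apply, Prod.ext_iff]
  simp only [eq_comm (a := y.2)]

theorem isHermitian_partialTranspose {X : BiOp A B} (hX : X.IsHermitian) :
    (partialTranspose A B X).IsHermitian := by
  ext x y
  exact hX.apply _ _

theorem trace_partialTranspose_mul [Fintype A] [Fintype B] (X Y : BiOp A B) :
    (partialTranspose A B X * Y).trace = (X * partialTranspose A B Y).trace := by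
  simp only [Matrix.trace, Matrix.diag_apply, Matrix.mul_apply, Fintype.sum_prod_type,
    partialTranspose_apply]
  refine Finset.sum_congr rfl fun a _ => ?_
  calc ∑ b, ∑ a', ∑ b', X (a, b') (a', b) * Y (a', b') (a, b)
      = ∑ b, ∑ b', ∑ a', X (a, b') (a', b) * Y (a', b') (a, b) :=
        Finset.sum_congr rfl fun b _ => Finset.sum_comm
    _ = ∑ b', ∑ b, ∑ a', X (a, b') (a', b) * Y (a', b') (a, b) := Finset.sum_comm
    _ = _ := Finset.sum_congr rfl fun b _ => Finset.sum_comm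

theorem posSemidef_tensor [Finite A₁] [Finite B₁] [Finite A₂] [Finite B₂]
    {X : BiOp A₁ B₁} {Y : BiOp A₂ B₂} (hX : X.PosSemidef) (hY : Y.PosSemidef) :
    (tensor X Y).PosSemidef :=
  (hX.kronecker hY).submatrix
    fun x : (A₁ × A₂) × (B₁ × B₂) => ((x.1.1, x.2.1), (x.1.2, x.2.2))

theorem partialTranspose_tensor (X : BiOp A₁ B₁) (Y : BiOp A₂ B₂) :
    partialTranspose (A₁ × A₂) (B₁ × B₂) (tensor X Y)
      = tensor (partialTranspose A₁ B₁ X) (partialTranspose A₂ B₂ Y) := rfl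

theorem tensor_mul [Fintype A₁] [Fintype B₁] [Fintype A₂] [Fintype B₂]
    (X X' : BiOp A₁ B₁) (Y Y' : BiOp A₂ B₂) :
    tensor X Y * tensor X' Y' = tensor (X * X') (Y * Y') := by
  ext x y
  simp only [tensor, Matrix.mul_apply, Matrix.of_apply, Finset.sum_mul_sum]
  rw [← Fintype.sum_prod_type', ← (Equiv.prodProdProdComm A₁ A₂ B₁ B₂).sum_comp]
  refine Finset.sum_congr rfl fun z _ => ?_
  simp only [Equiv.prodProdProdComm_apply]
  ring

theorem tensor_one [DecidableEq A₁] [DecidableEq B₁] [DecidableEq A₂] [DecidableEq B₂] :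
    tensor (1 : BiOp A₁ B₁) (1 : BiOp A₂ B₂) = 1 := by
  ext x y
  simp only [tensor, Matrix.of_apply, Matrix.one_apply, Prod.ext_iff, ← ite_and, mul_ite, mul_one,
    mul_zero]
  congr 1
  simp only [eq_iff_iff]
  tauto

theorem tensor_smul_left (c : ℂ) (X : BiOp A₁ B₁) (Y : BiOp A₂ B₂) :
    tensor (c • X) Y = c • tensor X Y := by
  ext x y
  simp [tensor, mul_assoc]

theorem tensor_smul_right (c : ℂ) (X : BiOp A₁ B₁) (Y : BiOp A₂ B₂) :
    tensor X (c • Y) = c • tensor X Y := by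
  ext x y
  simp [tensor, mul_left_comm]

theorem isHermitian_tensor {X : BiOp A₁ B₁} {Y : BiOp A₂ B₂} (hX : X.IsHermitian)
    (hY : Y.IsHermitian) : (tensor X Y).IsHermitian := by
  ext x y
  simp only [Matrix.conjTranspose_apply, tensor, Matrix.of_apply, star_mul', hX.apply, hY.apply]

theorem traceSnd_tensor [Fintype A₂] [Fintype B₂] (X : BiOp A₁ B₁) (Y : BiOp A₂ B₂) :
    traceSnd (tensor X Y) = Y.trace • X := by
  ext x y
  simp only [traceSnd, tensor, Matrix.of_apply, Matrix.smul_apply, smul_eq_mul, Matrix.trace,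
    Matrix.diag_apply, Fintype.sum_prod_type, ← Finset.mul_sum]
  exact mul_comm _ _

theorem traceFst_tensor [Fintype A₁] [Fintype B₁] (X : BiOp A₁ B₁) (Y : BiOp A₂ B₂) :
    traceFst (tensor X Y) = X.trace • Y := by
  ext x y
  simp only [traceFst, tensor, Matrix.of_apply, Matrix.smul_apply, smul_eq_mul, Matrix.trace,
    Matrix.diag_apply, Fintype.sum_prod_type, ← Finset.sum_mul]

theorem trace_traceSnd [Fintype A₁] [Fintype B₁] [Fintype A₂] [Fintype B₂]
    (X : BiOp (A₁ × A₂) (B₁ × B₂)) : (traceSnd X).trace = X.trace := by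
  simp only [Matrix.trace, Matrix.diag_apply, traceSnd, Matrix.of_apply, Fintype.sum_prod_type]
  exact Finset.sum_congr rfl fun a _ => Finset.sum_comm

/-- Sums over the index set of a tensor power factor over the copies. -/
theorem sum_prod_pi_pair [Fintype A] [Fintype B] (n : ℕ) (f : Fin n → A → B → ℂ) :
    ∑ a : Fin n → A, ∑ b : Fin n → B, ∏ i, f i (a i) (b i) = ∏ i, ∑ a, ∑ b, f i a b := by
  rw [Fintype.prod_sum]
  exact Finset.sum_congr rfl fun a _ => (Fintype.prod_sum fun i b => f i (a i) b).symm

theorem tensorPower_mul [Fintype A] [Fintype B] (X Y : BiOp A B) (n : ℕ) :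
    tensorPower X n * tensorPower Y n = tensorPower (X * Y) n := by
  ext x y
  simp only [tensorPower, Matrix.mul_apply, Matrix.of_apply, Fintype.sum_prod_type,
    ← Finset.prod_mul_distrib]
  exact sum_prod_pi_pair n fun i a b => X (x.1 i, x.2 i) (a, b) * Y (a, b) (y.1 i, y.2 i)

theorem tensorPower_conjTranspose (X : BiOp A B) (n : ℕ) :
    (tensorPower X n).conjTranspose = tensorPower X.conjTranspose n := by
  ext x y
  simp [tensorPower]

theorem tensorPower_smul (c : ℂ) (X : BiOp A B) (n : ℕ) :
    tensorPower (c • X) n = c ^ n • tensorPower X n := by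
  ext x y
  simp [tensorPower, Finset.prod_mul_distrib]

theorem tensorPower_one [DecidableEq A] [DecidableEq B] (n : ℕ) :
    tensorPower (1 : BiOp A B) n = 1 := by
  ext x y
  simp only [tensorPower, Matrix.of_apply, Matrix.one_apply, Prod.ext_iff, Finset.prod_ite_zero,
    Finset.prod_const_one, Finset.mem_univ, true_imp_iff, funext_iff, forall_and]

theorem trace_tensorPower [Fintype A] [Fintype B] (X : BiOp A B) (n : ℕ) :
    (tensorPower X n).trace = X.trace ^ n := by
  simp only [Matrix.trace, Matrix.diag_apply, tensorPower, Matrix.of_apply, Fintype.sum_prod_type]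
  rw [sum_prod_pi_pair n fun _ a b => X (a, b) (a, b)]
  simp

theorem partialTranspose_tensorPower (X : BiOp A B) (n : ℕ) :
    partialTranspose (Fin n → A) (Fin n → B) (tensorPower X n)
      = tensorPower (partialTranspose A B X) n := rfl

variable [Fintype A] [Fintype B] [DecidableEq A] [DecidableEq B]

theorem posSemidef_tensorPower {X : BiOp A B} (hX : X.PosSemidef) (n : ℕ) :
    (tensorPower X n).PosSemidef := by
  obtain ⟨Y, rfl⟩ := exists_conjTranspose_mul_self hX
  rw [← tensorPower_mul, ← tensorPower_conjTranspose]
  exact Matrix.posSemidef_conjTranspose_mul_self _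

theorem isState_tensorPower {X : BiOp A B} (hX : IsState X) (n : ℕ) :
    IsState (tensorPower X n) :=
  ⟨posSemidef_tensorPower hX.1 n, by rw [trace_tensorPower, hX.2, one_pow]⟩

theorem cfcAbs_tensorPower (X : BiOp A B) (n : ℕ) :
    CFC.abs (tensorPower X n) = tensorPower (CFC.abs X) n := by
  refine cfcAbs_eq_of_posSemidef (posSemidef_tensorPower (posSemidef_cfcAbs X) n) ?_
  rw [tensorPower_conjTranspose, tensorPower_mul, tensorPower_mul, CFC.abs_mul_abs]
  rfl

/-- Multiplicativity of the trace norm, which makes the logarithmic negativity additive. -/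
theorem traceNorm_tensorPower (X : BiOp A B) (n : ℕ) :
    traceNorm (tensorPower X n) = traceNorm X ^ n := by
  have h := coe_traceNorm (tensorPower X n)
  rw [cfcAbs_tensorPower, trace_tensorPower, ← coe_traceNorm] at h
  exact_mod_cast h

theorem hasPositiveBinegativity_tensorPower {X : BiOp A B} (hX : HasPositiveBinegativity X)
    (n : ℕ) : HasPositiveBinegativity (tensorPower X n) := by
  rw [HasPositiveBinegativity, partialTranspose_tensorPower, cfcAbs_tensorPower,
    partialTranspose_tensorPower]
  exact posSemidef_tensorPower hX n

end Tensor

/-! ### Completely positive maps -/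

section CompletelyPositive

variable {I J K : Type}

theorem IsCompletelyPositive.posSemidef {Λ : Op I →ₗ[ℂ] Op J} (hΛ : IsCompletelyPositive Λ)
    {X : Op I} (hX : X.PosSemidef) : (Λ X).PosSemidef :=
  (hΛ 1 (X.submatrix Prod.snd Prod.snd) (hX.submatrix _)).submatrix fun j => ((0 : Fin 1), j)

theorem IsCompletelyPositive.add {Λ Λ' : Op I →ₗ[ℂ] Op J} (hΛ : IsCompletelyPositive Λ)
    (hΛ' : IsCompletelyPositive Λ') : IsCompletelyPositive (Λ + Λ') :=
  fun k X hX => (hΛ k X hX).add (hΛ' k X hX)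

theorem IsCompletelyPositive.comp {Λ' : Op J →ₗ[ℂ] Op K} {Λ : Op I →ₗ[ℂ] Op J}
    (hΛ' : IsCompletelyPositive Λ') (hΛ : IsCompletelyPositive Λ) :
    IsCompletelyPositive (Λ' ∘ₗ Λ) :=
  fun k X hX => hΛ' k _ (hΛ k X hX)

/-- Measure the effect `M` and prepare `σ` if it occurs: `X ↦ Tr(X M) σ`. -/
def measurePrepare [Fintype I] (M : Op I) (σ : Op J) : Op I →ₗ[ℂ] Op J :=
  ((Matrix.traceLinearMap I ℂ ℂ).comp (LinearMap.mulRight ℂ M)).smulRight σ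

theorem measurePrepare_apply [Fintype I] (M : Op I) (σ : Op J) (X : Op I) :
    measurePrepare M σ X = (X * M).trace • σ := rfl

/-- With `M = N† N`, the ampliation of `X ↦ Tr(X M) σ` maps `X` to `Tr₂((1 ⊗ N) X (1 ⊗ N)†) ⊗ σ`. -/
theorem isCompletelyPositive_measurePrepare [Fintype I] [Finite J] {M : Op I} {σ : Op J}
    (hM : M.PosSemidef) (hσ : σ.PosSemidef) : IsCompletelyPositive (measurePrepare M σ) := by
  classical
  intro k X hX
  obtain ⟨N, rfl⟩ := exists_conjTranspose_mul_self hM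
  set V : Op (Fin k × I) := Matrix.kroneckerMap (· * ·) (1 : Op (Fin k)) N with hV
  have hY := hX.mul_mul_conjTranspose_same V
  have hVX : ∀ p q j, (V * X * V.conjTranspose) (p, j) (q, j)
      = (N * (Matrix.of fun i i' => X (p, i) (q, i')) * N.conjTranspose) j j := by
    intro p q j
    simp [hV, Matrix.mul_apply, Fintype.sum_prod_type, Matrix.one_apply,
      apply_ite (starRingEnd ℂ)]
  have hsum : (∑ j : I, (V * X * V.conjTranspose).submatrix (fun p : Fin k => (p, j))
      fun p : Fin k => (p, j)).PosSemidef :=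
    Matrix.posSemidef_sum _ fun j _ => hY.submatrix _
  have hk : ampliation k (measurePrepare (N.conjTranspose * N) σ) X = Matrix.kroneckerMap (· * ·)
      (∑ j : I, (V * X * V.conjTranspose).submatrix (fun p : Fin k => (p, j))
        fun p : Fin k => (p, j)) σ := by
    ext p q
    simp only [ampliation, measurePrepare_apply, Matrix.of_apply, Matrix.smul_apply, smul_eq_mul,
      Matrix.kroneckerMap_apply, Matrix.sum_apply, Matrix.submatrix_apply, hVX]
    rw [← Matrix.mul_assoc, Matrix.trace_mul_comm, ← Matrix.mul_assoc]
    rfl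
  rw [hk]
  exact hsum.kronecker hσ

/-- Relabelling (pulling back along `f`) the basis of a system. -/
def relabel (f : J → I) : Op I →ₗ[ℂ] Op J where
  toFun X := X.submatrix f f
  map_add' _ _ := rfl
  map_smul' _ _ := rfl

theorem isCompletelyPositive_relabel (f : J → I) : IsCompletelyPositive (relabel f) :=
  fun k _ hX => hX.submatrix fun x : Fin k × J => (x.1, f x.2)

theorem isTracePreserving_relabel [Fintype I] [Fintype J] (e : J ≃ I) :
    IsTracePreserving (relabel e) :=
  fun X => e.sum_comp fun i => X i i

/-- The map `Λ ⊗ id_C`, acting block by block. -/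
def tensorId (C : Type) (Λ : Op I →ₗ[ℂ] Op J) : Op (I × C) →ₗ[ℂ] Op (J × C) where
  toFun X := Matrix.of fun x y => Λ (Matrix.of fun i i' => X (i, x.2) (i', y.2)) x.1 y.1
  map_add' X Y := by
    ext x y
    exact congrFun (congrFun (Λ.map_add (Matrix.of fun i i' => X (i, x.2) (i', y.2))
      (Matrix.of fun i i' => Y (i, x.2) (i', y.2))) x.1) y.1
  map_smul' c X := by
    ext x y
    exact congrFun (congrFun (Λ.map_smul c (Matrix.of fun i i' => X (i, x.2) (i', y.2))) x.1) y.1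

/-- The ampliation `id_k ⊗ (Λ ⊗ id_C)` is, up to relabelling, the ampliation of `Λ` by a system
of dimension `k · |C|`. -/
theorem isCompletelyPositive_tensorId (C : Type) [Fintype C] {Λ : Op I →ₗ[ℂ] Op J}
    (hΛ : IsCompletelyPositive Λ) : IsCompletelyPositive (tensorId C Λ) := by
  intro k X hX
  let e := Fintype.equivFin (Fin k × C)
  have h := (hΛ _ (X.submatrix (fun z : Fin (Fintype.card (Fin k × C)) × I =>
      ((e.symm z.1).1, (z.2, (e.symm z.1).2))) _) (hX.submatrix _)).submatrix
      (fun x : Fin k × (J × C) => (e (x.1, x.2.2), x.2.1))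
  convert h using 1
  ext p q
  simp [ampliation, tensorId]

theorem isTracePreserving_tensorId [Fintype I] [Fintype J] (C : Type) [Fintype C]
    {Λ : Op I →ₗ[ℂ] Op J} (hΛ : IsTracePreserving Λ) : IsTracePreserving (tensorId C Λ) := by
  intro X
  simp only [Matrix.trace, Matrix.diag_apply, tensorId, LinearMap.coe_mk, AddHom.coe_mk,
    Matrix.of_apply, Fintype.sum_prod_type_right]
  exact Finset.sum_congr rfl fun c _ => hΛ (Matrix.of fun i i' => X (i, c) (i', c))

end CompletelyPositive

/-! ### PPT operations -/

section PPT

variable {A B A' B' : Type}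

/-- PPT operations contract the trace norm of the partial transpose: if `T_B(X) = P - Q` with
`P`, `Q` positive, then `T_B(Λ(X))` is the difference of their images under the positive
trace-preserving map `T_B ∘ Λ ∘ T_B`. -/
theorem IsPPTOperation.traceNorm_partialTranspose_le [Fintype A] [Fintype B] [Fintype A']
    [Fintype B'] [DecidableEq A'] [DecidableEq B']
    {Λ : BiOp A B →ₗ[ℂ] BiOp A' B'} (hΛ : IsPPTOperation Λ) {X P Q : BiOp A B}
    (hP : P.PosSemidef) (hQ : Q.PosSemidef) (hX : partialTranspose A B X = P - Q) :
    traceNorm (partialTranspose A' B' (Λ X)) ≤ P.trace.re + Q.trace.re := by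
  set Λ' := partialTranspose A' B' ∘ₗ Λ ∘ₗ partialTranspose A B with hΛ'
  have htr : ∀ Y, (Λ' Y).trace = Y.trace := fun Y => hΛ.2.1 (partialTranspose A B Y)
  have hX' : partialTranspose A' B' (Λ X) = Λ' P - Λ' Q := by
    rw [← map_sub, ← hX]
    rfl
  rw [hX', ← htr P, ← htr Q]
  exact traceNorm_sub_le (hΛ.2.2.posSemidef hP) (hΛ.2.2.posSemidef hQ)

/-- The operation `Λ ⊗ id` on a bipartite system and a bystander `CA CB`, followed by a local
relabelling of the output of each party. -/
def withBystander {CA CB P Q : Type} (Λ : BiOp A B →ₗ[ℂ] BiOp A' B') (eA : P ≃ A' × CA)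
    (eB : Q ≃ B' × CB) : BiOp (A × CA) (B × CB) →ₗ[ℂ] BiOp P Q :=
  relabel ((Equiv.prodCongr eA eB).trans (Equiv.prodProdProdComm A' CA B' CB)) ∘ₗ
    tensorId (CA × CB) Λ ∘ₗ relabel (Equiv.prodProdProdComm A B CA CB)

theorem isPPTOperation_withBystander {CA CB P Q : Type} [Fintype A] [Fintype B] [Fintype A']
    [Fintype B'] [Fintype CA] [Fintype CB] [Fintype P]
    [Fintype Q] {Λ : BiOp A B →ₗ[ℂ] BiOp A' B'} (hΛ : IsPPTOperation Λ) (eA : P ≃ A' × CA)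
    (eB : Q ≃ B' × CB) : IsPPTOperation (withBystander Λ eA eB) := by
  refine ⟨(isCompletelyPositive_relabel _).comp ((isCompletelyPositive_tensorId _ hΛ.1).comp
    (isCompletelyPositive_relabel _)), fun X => ?_, ?_⟩
  · exact (isTracePreserving_relabel _ _).trans ((isTracePreserving_tensorId _ hΛ.2.1 _).trans
      (isTracePreserving_relabel _ _))
  · -- Partial transposition acts on the bystander as well, but there the two cancel.
    have h : partialTranspose P Q ∘ₗ withBystander Λ eA eB ∘ₗ
        partialTranspose (A × CA) (B × CB) =
        withBystander (partialTranspose A' B' ∘ₗ Λ ∘ₗ partialTranspose A B) eA eB := rfl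
    rw [h]
    exact (isCompletelyPositive_relabel _).comp ((isCompletelyPositive_tensorId _ hΛ.2.2).comp
      (isCompletelyPositive_relabel _))

theorem withBystander_tensor {CA CB P Q : Type} (Λ : BiOp A B →ₗ[ℂ] BiOp A' B')
    (eA : P ≃ A' × CA) (eB : Q ≃ B' × CB) (X : BiOp A B) (τ : BiOp CA CB) (x y : P × Q) :
    withBystander Λ eA eB (tensor X τ) x y
      = Λ X ((eA x.1).1, (eB x.2).1) ((eA y.1).1, (eB y.2).1)
        * τ ((eA x.1).2, (eB x.2).2) ((eA y.1).2, (eB y.2).2) := by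
  have h : (Matrix.of fun i i' => tensor X τ ((i.1, (eA x.1).2), (i.2, (eB x.2).2))
      ((i'.1, (eA y.1).2), (i'.2, (eB y.2).2)))
      = τ ((eA x.1).2, (eB x.2).2) ((eA y.1).2, (eB y.2).2) • X := by
    ext i i'
    simp [tensor, mul_comm]
  have h2 : withBystander Λ eA eB (tensor X τ) x y
      = Λ (Matrix.of fun i i' => tensor X τ ((i.1, (eA x.1).2), (i.2, (eB x.2).2))
      ((i'.1, (eA y.1).2), (i'.2, (eB y.2).2))) ((eA x.1).1, (eB x.2).1)
        ((eA y.1).1, (eB y.2).1) := rfl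
  rw [h2, h, map_smul, Matrix.smul_apply, smul_eq_mul, mul_comm]

end PPT

/-! ### Maximally entangled states and the swap operator -/

/-- The swap (flip) operator `|ij⟩ ↦ |ji⟩` of two `d`-level systems. -/
def swapOp (d : ℕ) : BiOp (Fin d) (Fin d) :=
  Matrix.of fun x y => if x.1 = y.2 ∧ x.2 = y.1 then 1 else 0

theorem isHermitian_swapOp (d : ℕ) : (swapOp d).IsHermitian := by
  ext x y
  simp only [swapOp, Matrix.conjTranspose_apply, Matrix.of_apply, apply_ite star, star_one,
    star_zero]
  congr 1
  simp only [eq_iff_iff]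
  tauto

theorem swapOp_mul_swapOp (d : ℕ) : swapOp d * swapOp d = 1 := by
  ext x y
  simp only [swapOp, Matrix.mul_apply, Matrix.of_apply, Fintype.sum_prod_type, ite_and,
    Matrix.one_apply, Prod.ext_iff]
  simp

theorem trace_swapOp (d : ℕ) : (swapOp d).trace = d := by
  simp only [swapOp, Matrix.trace, Matrix.diag_apply, Matrix.of_apply, Fintype.sum_prod_type,
    ite_and]
  simp

theorem partialTranspose_maxEntangled (d : ℕ) :
    partialTranspose (Fin d) (Fin d) (maxEntangled d) = (d : ℂ)⁻¹ • swapOp d := by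
  have hs : ((1 / Real.sqrt d : ℝ) : ℂ) * ((1 / Real.sqrt d : ℝ) : ℂ) = (d : ℂ)⁻¹ := by
    rw [← Complex.ofReal_mul, ← sq, div_pow, Real.sq_sqrt (Nat.cast_nonneg d), one_pow]
    simp
  ext x y
  simp only [partialTranspose_apply, maxEntangled, Matrix.vecMulVec_apply, maxEntangledVec,
    Pi.star_apply, swapOp, Matrix.smul_apply, Matrix.of_apply, smul_eq_mul, RCLike.star_def,
    apply_ite (starRingEnd ℂ), map_zero, Complex.conj_ofReal]
  by_cases h1 : x.1 = y.2 <;> by_cases h2 : x.2 = y.1 <;>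
    simp only [h1, h2, if_true, if_false, and_true, and_false, mul_zero, zero_mul, hs, mul_one,
      and_self, eq_comm (a := y.1)]

theorem partialTranspose_swapOp {d : ℕ} (hd : 1 ≤ d) :
    partialTranspose (Fin d) (Fin d) (swapOp d) = (d : ℂ) • maxEntangled d := by
  have hd' : (d : ℂ) ≠ 0 := Nat.cast_ne_zero.2 (by omega)
  rw [← partialTranspose_partialTranspose ((d : ℂ) • maxEntangled d), map_smul,
    partialTranspose_maxEntangled, smul_smul, mul_inv_cancel₀ hd', one_smul]

theorem posSemidef_maxEntangled (d : ℕ) : (maxEntangled d).PosSemidef :=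
  Matrix.posSemidef_vecMulVec_self_star _

theorem trace_maxEntangled {d : ℕ} (hd : 1 ≤ d) : (maxEntangled d).trace = 1 := by
  have hd' : (d : ℂ) ≠ 0 := Nat.cast_ne_zero.2 (by omega)
  rw [← trace_partialTranspose, partialTranspose_maxEntangled, Matrix.trace_smul, trace_swapOp,
    smul_eq_mul, inv_mul_cancel₀ hd']

theorem maxEntangled_mul_self {d : ℕ} (hd : 1 ≤ d) :
    maxEntangled d * maxEntangled d = maxEntangled d := by
  have h := trace_maxEntangled hd
  rw [maxEntangled, Matrix.trace_vecMulVec, dotProduct_comm] at h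
  rw [maxEntangled, Matrix.vecMulVec_mul_vecMulVec, h]
  simp

theorem isState_maxEntangled {d : ℕ} (hd : 1 ≤ d) : IsState (maxEntangled d) :=
  ⟨posSemidef_maxEntangled d, trace_maxEntangled hd⟩

theorem isHermitian_tensorPower_swapOp (d n : ℕ) : (tensorPower (swapOp d) n).IsHermitian := by
  rw [Matrix.IsHermitian, tensorPower_conjTranspose, (isHermitian_swapOp d).eq]

theorem tensorPower_swapOp_mul_self (d n : ℕ) :
    tensorPower (swapOp d) n * tensorPower (swapOp d) n = 1 := by
  rw [tensorPower_mul, swapOp_mul_swapOp, tensorPower_one]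

theorem partialTranspose_tensorPower_bell (m : ℕ) :
    partialTranspose (Fin m → Fin 2) (Fin m → Fin 2) (tensorPower bell m)
      = ((2 : ℂ) ^ m)⁻¹ • tensorPower (swapOp 2) m := by
  rw [partialTranspose_tensorPower, bell, partialTranspose_maxEntangled, tensorPower_smul]
  simp

/-! ### The exact cost of states with positive binegativity -/

section Cost

variable {A B : Type} [Fintype A] [Fintype B] [DecidableEq A] [DecidableEq B]

theorem one_le_traceNorm_partialTranspose {σ : BiOp A B} (hσ : IsState σ) :
    1 ≤ traceNorm (partialTranspose A B σ) := by
  have h := re_trace_le_traceNorm (isHermitian_partialTranspose hσ.1.1)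
  rwa [trace_partialTranspose, hσ.2, Complex.one_re] at h

theorem logNegativity_nonneg {σ : BiOp A B} (hσ : IsState σ) : 0 ≤ logNegativity σ :=
  Real.logb_nonneg one_lt_two (one_le_traceNorm_partialTranspose hσ)

theorem two_rpow_logNegativity {σ : BiOp A B} (hσ : IsState σ) :
    (2 : ℝ) ^ logNegativity σ = traceNorm (partialTranspose A B σ) :=
  Real.rpow_logb two_pos (by norm_num)
    (zero_lt_one.trans_le (one_le_traceNorm_partialTranspose hσ))

/-- The operation measures whether the input is `Φ^{⊗ m}`, and prepares `σ` if it is and the state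
`ω = T_B(|T_B(σ)|) / N`, with `N = ‖T_B(σ)‖₁`, if it is not. After conjugation by partial
transposes, it measures the two eigenspaces of the swap operator and prepares multiples of
`(2 ^ m - 1) |T_B(σ)| / N + T_B(σ)` and `(2 ^ m + 1) |T_B(σ)| / N - T_B(σ)`. -/
theorem exists_isPPTOperation_of_traceNorm_add_one_le {σ : BiOp A B} (hσ : IsState σ)
    (hbi : HasPositiveBinegativity σ) {m : ℕ}
    (hm : traceNorm (partialTranspose A B σ) + 1 ≤ 2 ^ m) :
    ∃ Λ : BiOp (Fin m → Fin 2) (Fin m → Fin 2) →ₗ[ℂ] BiOp A B,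
      IsPPTOperation Λ ∧ Λ (tensorPower bell m) = σ := by
  have hN1 := one_le_traceNorm_partialTranspose hσ
  have hNc := coe_traceNorm (partialTranspose A B σ)
  have hherm := isHermitian_partialTranspose hσ.1.1
  unfold HasPositiveBinegativity at hbi
  have htrT : (partialTranspose A B (CFC.abs (partialTranspose A B σ))).trace
      = (CFC.abs (partialTranspose A B σ)).trace := rfl
  set σ' := partialTranspose A B σ with hσ'
  set N := traceNorm σ' with hN
  have hN0 : 0 < N := by linarith
  have hNc0 : (N : ℂ) ≠ 0 := by exact_mod_cast hN0.ne'
  set Φ := tensorPower bell m with hΦ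
  have hΦst : IsState Φ := isState_tensorPower (isState_maxEntangled one_le_two) m
  have hΦΦ : Φ * Φ = Φ := by
    rw [hΦ, tensorPower_mul, bell, maxEntangled_mul_self one_le_two]
  set F := tensorPower (swapOp 2) m with hF
  have hFh : F.IsHermitian := isHermitian_tensorPower_swapOp 2 m
  have hFF : F * F = 1 := tensorPower_swapOp_mul_self 2 m
  set ω : BiOp A B := (N : ℂ)⁻¹ • partialTranspose A B (CFC.abs σ') with hω
  have hinv : (0 : ℂ) ≤ (N : ℂ)⁻¹ := by
    rw [← Complex.ofReal_inv]
    exact Complex.zero_le_real.2 (inv_nonneg.2 hN0.le)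
  have hωst : IsState ω := by
    refine ⟨hbi.smul hinv, ?_⟩
    rw [hω, Matrix.trace_smul, htrT, ← hNc, smul_eq_mul, inv_mul_cancel₀ hNc0]
  set ω' : BiOp A B := (N : ℂ)⁻¹ • CFC.abs σ' with hω'
  have hTω : partialTranspose A B ω = ω' := rfl
  refine ⟨measurePrepare Φ σ + measurePrepare (1 - Φ) ω, ⟨?_, ?_, ?_⟩, ?_⟩
  · exact (isCompletelyPositive_measurePrepare hΦst.1 hσ.1).add
      (isCompletelyPositive_measurePrepare (posSemidef_one_sub_of_projection hΦst.1.1 hΦΦ) hωst.1)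
  · intro X
    simp only [LinearMap.add_apply, measurePrepare_apply, Matrix.trace_add, Matrix.trace_smul,
      hσ.2, hωst.2, Matrix.mul_sub, Matrix.trace_sub, smul_eq_mul, mul_one]
    ring
  · set k : ℂ := ((2 : ℂ) ^ m)⁻¹ with hk
    have hmap : partialTranspose A B ∘ₗ (measurePrepare Φ σ + measurePrepare (1 - Φ) ω) ∘ₗ
        partialTranspose (Fin m → Fin 2) (Fin m → Fin 2)
        = measurePrepare (1 + F) ((1 / 2 : ℂ) • (k • σ' + (1 - k) • ω'))
          + measurePrepare (1 - F) ((1 / 2 : ℂ) • ((1 + k) • ω' - k • σ')) := by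
      refine LinearMap.ext fun X => ?_
      have h1 : partialTranspose _ _ Φ = k • F := partialTranspose_tensorPower_bell m
      simp only [LinearMap.comp_apply, LinearMap.add_apply, measurePrepare_apply, map_add,
        map_smul, trace_partialTranspose_mul, h1, hTω, ← hσ', Matrix.mul_sub, Matrix.mul_add,
        Matrix.mul_one, Matrix.mul_smul, Matrix.trace_sub, Matrix.trace_add, Matrix.trace_smul,
        trace_partialTranspose, smul_eq_mul]
      module
    have hkr : k = (((2 : ℝ) ^ m)⁻¹ : ℝ) := by
      rw [hk]
      push_cast
      rfl
    have hK : (0 : ℝ) < 2 ^ m := by positivity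
    have hcoef : ∀ c : ℝ, 0 ≤ c → ((c : ℂ) • CFC.abs σ').PosSemidef := fun c hc =>
      (posSemidef_cfcAbs σ').smul (Complex.zero_le_real.2 hc)
    have hpre : (0 : ℂ) ≤ ((1 / 2 * ((2 : ℝ) ^ m)⁻¹ : ℝ) : ℂ) :=
      Complex.zero_le_real.2 (by positivity)
    have hKc : ((2 : ℂ) ^ m) ≠ 0 := by positivity
    rw [hmap]
    refine (isCompletelyPositive_measurePrepare (posSemidef_one_add_of_involution hFh hFF) ?_).add
      (isCompletelyPositive_measurePrepare (posSemidef_one_sub_of_involution hFh hFF) ?_)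
    -- Both prepared operators dominate multiples of `|T_B(σ)| ± T_B(σ)`, by `N + 1 ≤ 2 ^ m`.
    · have h := ((posSemidef_cfcAbs_add_self hherm).add (hcoef ((2 ^ m - 1) / N - 1)
        (by rw [sub_nonneg, le_div_iff₀ hN0]; linarith))).smul hpre
      convert h using 1
      rw [hω', hk]
      push_cast
      match_scalars <;> field_simp
      ring
    · have h := ((posSemidef_cfcAbs_sub_self hherm).add (hcoef ((2 ^ m + 1) / N - 1)
        (by rw [sub_nonneg, le_div_iff₀ hN0]; linarith))).smul hpre
      convert h using 1
      rw [hω', hk]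
      push_cast
      match_scalars <;> field_simp
      ring
  · simp only [LinearMap.add_apply, measurePrepare_apply, Matrix.mul_sub, Matrix.mul_one, hΦΦ,
      sub_self, Matrix.trace_zero, zero_smul, add_zero, hΦst.2, one_smul]

/-- The logarithmic negativity of a state with positive binegativity is an achievable rate, since
`m = ⌈n L_N(ρ)⌉ + 1` Bell pairs suffice for `n` copies. -/
theorem isAchievable_logNegativity {ρ : BiOp A B} (hρ : IsState ρ)
    (hbi : HasPositiveBinegativity ρ) : IsAchievable ρ (logNegativity ρ) := by
  intro δ hδ
  obtain ⟨n, hn⟩ := exists_nat_gt (2 / δ)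
  have hn0 : (0 : ℝ) < n := lt_trans (by positivity) hn
  have hL := logNegativity_nonneg hρ
  have hN1 := one_le_traceNorm_partialTranspose hρ
  refine ⟨⌈n * logNegativity ρ⌉₊ + 1, n, by exact_mod_cast hn0, ?_, ?_⟩
  · refine exists_isPPTOperation_of_traceNorm_add_one_le (isState_tensorPower hρ n)
      (hasPositiveBinegativity_tensorPower hbi n) ?_
    rw [partialTranspose_tensorPower, traceNorm_tensorPower]
    have h1 : traceNorm (partialTranspose A B ρ) ^ n ≤ 2 ^ ⌈n * logNegativity ρ⌉₊ := by
      rw [← two_rpow_logNegativity hρ, ← Real.rpow_mul_natCast zero_le_two, ← Real.rpow_natCast]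
      exact Real.rpow_le_rpow_of_exponent_le one_le_two (by
        rw [mul_comm]
        exact Nat.le_ceil _)
    have h2 := one_le_pow₀ hN1 (n := n)
    rw [pow_succ]
    linarith
  · have hc := (Nat.ceil_lt_add_one (mul_nonneg hn0.le hL)).le
    have h2 : 2 < n * δ := by rwa [div_lt_iff₀ hδ] at hn
    rw [div_le_iff₀ hn0]
    push_cast
    linarith [mul_comm (logNegativity ρ + δ) n, mul_add (n : ℝ) (logNegativity ρ) δ]

/-- No achievable rate is smaller than the logarithmic negativity, which is additive, does not
increase under PPT operations and equals `m` on `m` Bell pairs. -/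
theorem logNegativity_le_of_isAchievable {ρ : BiOp A B} (hρ : IsState ρ) {r : ℝ}
    (hr : IsAchievable ρ r) : logNegativity ρ ≤ r := by
  refine le_of_forall_pos_le_add fun δ hδ => ?_
  obtain ⟨m, n, hn, ⟨Λ, hΛ, hΛρ⟩, hmn⟩ := hr δ hδ
  refine le_trans ?_ hmn
  rw [le_div_iff₀ (by exact_mod_cast hn)]
  set F := tensorPower (swapOp 2) m with hF
  have hFh : F.IsHermitian := isHermitian_tensorPower_swapOp 2 m
  have hFF : F * F = 1 := tensorPower_swapOp_mul_self 2 m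
  have hc : (0 : ℂ) ≤ ((1 / 2 * ((2 : ℝ) ^ m)⁻¹ : ℝ) : ℂ) :=
    Complex.zero_le_real.2 (by positivity)
  -- The partial transpose of `Φ^{⊗ m}` is `2⁻ᵐ F = 2⁻ᵐ ((1 + F) - (1 - F)) / 2`.
  have hle := hΛ.traceNorm_partialTranspose_le (X := tensorPower bell m)
    ((posSemidef_one_add_of_involution hFh hFF).smul hc)
    ((posSemidef_one_sub_of_involution hFh hFF).smul hc) (by
      rw [partialTranspose_tensorPower_bell]
      push_cast
      module)
  rw [hΛρ, partialTranspose_tensorPower, traceNorm_tensorPower, ← Complex.add_re,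
    ← Matrix.trace_add] at hle
  have htr : ((((1 / 2 * ((2 : ℝ) ^ m)⁻¹ : ℝ) : ℂ) • (1 + F)
      + ((1 / 2 * ((2 : ℝ) ^ m)⁻¹ : ℝ) : ℂ) • (1 - F) : BiOp (Fin m → Fin 2) (Fin m → Fin 2)).trace)
      = ((2 ^ m : ℝ) : ℂ) := by
    rw [← smul_add, add_add_sub_cancel, Matrix.trace_smul, Matrix.trace_add, Matrix.trace_one]
    simp only [Fintype.card_prod, Fintype.card_fun, Fintype.card_fin]
    push_cast
    rw [smul_eq_mul]
    field_simp
    ring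
  rw [htr, Complex.ofReal_re, ← two_rpow_logNegativity hρ, ← Real.rpow_mul_natCast zero_le_two,
    ← Real.rpow_natCast] at hle
  exact (Real.rpow_le_rpow_left_iff one_lt_two).1 hle

theorem exactCost_eq_logNegativity {ρ : BiOp A B} (hρ : IsState ρ)
    (hbi : HasPositiveBinegativity ρ) : exactCost ρ = (logNegativity ρ : EReal) :=
  le_antisymm (iInf₂_le _ (isAchievable_logNegativity hρ hbi))
    (le_iInf₂ fun _ hr => EReal.coe_le_coe_iff.2 (logNegativity_le_of_isAchievable hρ hr))

end Cost

/-! ### Catalysis from broadcasts -/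

section Catalysis

variable {A B : Type}

/-- How a party holding `2n` system copies and `n` catalyst copies groups them: the first half of
the system copies pairs up with the catalyst copies, and the second half stays apart. -/
def regroup (n : ℕ) (A : Type) :
    (Fin (n + n) → A) × (Fin n → A) ≃ (Fin n → A × A) × (Fin n → A) where
  toFun x := (fun i => (x.1 (Fin.castAdd n i), x.2 i), fun i => x.1 (Fin.natAdd n i))
  invFun y := (Fin.append (fun i => (y.1 i).1) y.2, fun i => (y.1 i).2)
  left_inv x := Prod.ext (Fin.append_castAdd_natAdd (f := x.1)) rfl
  right_inv y := Prod.ext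
    (funext fun i => Prod.ext (Fin.append_left (fun i => (y.1 i).1) y.2 i) rfl)
    (funext fun i => Fin.append_right (fun i => (y.1 i).1) y.2 i)

variable {μ : BiOp (A × A) (B × B)} {ρ : BiOp A B} {n : ℕ}

/-- `μ^{⊗ n} ⊗ ρ^{⊗ n}`, where the first halves of the copies of `μ` together with `ρ^{⊗ n}` form
the system and the second halves of the copies of `μ` form the catalyst. -/
def regroupedOutput (μ : BiOp (A × A) (B × B)) (ρ : BiOp A B) (n : ℕ) :
    BiOp ((Fin (n + n) → A) × (Fin n → A)) ((Fin (n + n) → B) × (Fin n → B)) :=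
  Matrix.of fun x y =>
    tensorPower μ n ((regroup n A x.1).1, (regroup n B x.2).1)
        ((regroup n A y.1).1, (regroup n B y.2).1)
      * tensorPower ρ n ((regroup n A x.1).2, (regroup n B x.2).2)
          ((regroup n A y.1).2, (regroup n B y.2).2)

theorem traceSnd_regroupedOutput [Fintype A] [Fintype B] (hμ : traceSnd μ = ρ) :
    traceSnd (regroupedOutput μ ρ n) = tensorPower ρ (n + n) := by
  ext x y
  -- Only the copies of `μ` depend on the traced-out catalyst, and the trace of each is `ρ`.
  have h : traceSnd (regroupedOutput μ ρ n) x y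
      = ∑ a : Fin n → A, ∑ b : Fin n → B,
        (∏ i, μ ((x.1 (Fin.castAdd n i), a i), (x.2 (Fin.castAdd n i), b i))
          ((y.1 (Fin.castAdd n i), a i), (y.2 (Fin.castAdd n i), b i)))
        * ∏ i, ρ (x.1 (Fin.natAdd n i), x.2 (Fin.natAdd n i))
          (y.1 (Fin.natAdd n i), y.2 (Fin.natAdd n i)) := rfl
  rw [h]
  simp only [← Finset.sum_mul]
  rw [sum_prod_pi_pair n fun i a b => μ ((x.1 (Fin.castAdd n i), a), (x.2 (Fin.castAdd n i), b))
    ((y.1 (Fin.castAdd n i), a), (y.2 (Fin.castAdd n i), b))]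
  exact (congrArg (· * _) (Finset.prod_congr rfl fun i _ =>
    congrFun (congrFun hμ (x.1 (Fin.castAdd n i), x.2 (Fin.castAdd n i))) _)).trans
    (Fin.prod_univ_add fun i => ρ (x.1 i, x.2 i) (y.1 i, y.2 i)).symm

theorem traceFst_regroupedOutput [Fintype A] [Fintype B] (hμ : traceFst μ = ρ)
    (hρ : ρ.trace = 1) : traceFst (regroupedOutput μ ρ n) = tensorPower ρ n := by
  ext x y
  -- The traced-out system consists of first halves of `μ`, and of `n` copies of `ρ`.
  let f : Fin (n + n) → A → B → ℂ := fun j a b =>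
    Fin.addCases (motive := fun _ => ℂ)
      (fun i => μ ((a, x.1 i), (b, x.2 i)) ((a, y.1 i), (b, y.2 i))) (fun _ => ρ (a, b) (a, b)) j
  have h : traceFst (regroupedOutput μ ρ n) x y
      = ∑ a : Fin (n + n) → A, ∑ b : Fin (n + n) → B, ∏ j, f j (a j) (b j) := by
    refine Finset.sum_congr rfl fun a _ => Finset.sum_congr rfl fun b _ => ?_
    rw [Fin.prod_univ_add]
    simp only [f, Fin.addCases_left, Fin.addCases_right]
    rfl
  rw [h, sum_prod_pi_pair, Fin.prod_univ_add]
  simp only [f, Fin.addCases_left, Fin.addCases_right]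
  have htr : ∑ a, ∑ b, ρ (a, b) (a, b) = 1 := by
    rw [← hρ]
    exact (Fintype.sum_prod_type fun x => ρ x x).symm
  rw [htr, Finset.prod_const_one, mul_one]
  exact Finset.prod_congr rfl fun i _ => congrFun (congrFun hμ (x.1 i, x.2 i)) (y.1 i, y.2 i)

/-- If Bell pairs can be turned into a broadcast of `ρ` at rate `r`, then with a catalyst they can
be turned into `ρ` at rate `r / 2`. The catalyst is `ρ^{⊗ n}`: prepare `μ^{⊗ n}`, hand out its
first halves together with the catalyst, and keep its second halves as the new catalyst. The
system is then exactly in the state `ρ^{⊗ 2n}`, because the old catalyst is independent of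
`μ^{⊗ n}`. -/
theorem IsTwoCopyBroadcast.isCatalyticallyAchievable [Fintype A] [Fintype B] [DecidableEq A]
    [DecidableEq B] (hρ : IsState ρ) (hμ : IsTwoCopyBroadcast μ ρ) {r : ℝ}
    (hr : IsAchievable μ r) : IsCatalyticallyAchievable ρ (r / 2) := by
  intro δ hδ
  obtain ⟨m, n, hn, ⟨Λ, hΛ, hΛμ⟩, hmn⟩ := hr (2 * δ) (by positivity)
  have hout : withBystander Λ (regroup n A) (regroup n B)
      (tensor (tensorPower bell m) (tensorPower ρ n)) = regroupedOutput μ ρ n := by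
    ext x y
    rw [withBystander_tensor, hΛμ]
    rfl
  refine ⟨m, n + n, by omega, ⟨Fin n → A, Fin n → B, inferInstance, inferInstance,
    tensorPower ρ n, withBystander Λ (regroup n A) (regroup n B), isState_tensorPower hρ n,
    isPPTOperation_withBystander hΛ _ _, ?_, ?_⟩, ?_⟩
  · rw [hout, traceSnd_regroupedOutput hμ.2.1]
  · rw [hout, traceFst_regroupedOutput hμ.2.2 hρ.2]
  · push_cast
    rw [← two_mul, mul_comm (2 : ℝ), ← div_div]
    linarith

theorem IsTwoCopyBroadcast.catalyticExactCost_le [Fintype A] [Fintype B] [DecidableEq A]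
    [DecidableEq B] (hρ : IsState ρ) (hμ : IsTwoCopyBroadcast μ ρ)
    (hbi : HasPositiveBinegativity μ) : catalyticExactCost ρ ≤ exactCost μ / 2 := by
  rw [exactCost_eq_logNegativity hμ.1 hbi]
  have h : ((logNegativity μ : ℝ) : EReal) / 2 = ((logNegativity μ / 2 : ℝ) : EReal) := by
    rw [EReal.coe_div]
    rfl
  rw [h]
  exact iInf₂_le _ (hμ.isCatalyticallyAchievable hρ (isAchievable_logNegativity hμ.1 hbi))

end Catalysis

/-! ### The example -/

section Example

variable {d : ℕ}

theorem isState_maxMixed (hd : 1 ≤ d) : IsState (maxMixed d) := by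
  have hd' : (d : ℂ) ≠ 0 := Nat.cast_ne_zero.2 (by omega)
  refine ⟨Matrix.PosSemidef.one.smul (by positivity), ?_⟩
  rw [maxMixed, Matrix.trace_smul, Matrix.trace_one]
  simp only [Fintype.card_prod, Fintype.card_fin, smul_eq_mul]
  push_cast
  field_simp

theorem isState_exampleState (hd : 1 ≤ d) : IsState (exampleState d) := by
  refine ⟨((isState_maxEntangled hd).1.smul (by positivity)).add
    ((isState_maxMixed hd).1.smul (by positivity)), ?_⟩
  rw [exampleState, Matrix.trace_add, Matrix.trace_smul, Matrix.trace_smul,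
    (isState_maxEntangled hd).2, (isState_maxMixed hd).2]
  norm_num

theorem isTwoCopyBroadcast_exampleBroadcast (hd : 1 ≤ d) :
    IsTwoCopyBroadcast (exampleBroadcast d) (exampleState d) := by
  have hE := isState_maxEntangled hd
  have hM := isState_maxMixed hd
  have hsnd : traceSnd (exampleBroadcast d) = exampleState d := by
    have h : traceSnd (exampleBroadcast d)
        = (1 / 2 : ℂ) • (traceSnd (tensor (maxEntangled d) (maxMixed d))
          + traceSnd (tensor (maxMixed d) (maxEntangled d))) := by
      ext x y
      simp [traceSnd, exampleBroadcast, Finset.mul_sum, Finset.sum_add_distrib, mul_add]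
    rw [h, traceSnd_tensor, traceSnd_tensor, hE.2, hM.2, one_smul, one_smul, smul_add]
    rfl
  have hfst : traceFst (exampleBroadcast d) = exampleState d := by
    have h : traceFst (exampleBroadcast d)
        = (1 / 2 : ℂ) • (traceFst (tensor (maxEntangled d) (maxMixed d))
          + traceFst (tensor (maxMixed d) (maxEntangled d))) := by
      ext x y
      simp [traceFst, exampleBroadcast, Finset.mul_sum, Finset.sum_add_distrib, mul_add]
    rw [h, traceFst_tensor, traceFst_tensor, hE.2, hM.2, one_smul, one_smul, smul_add, add_comm]
    rfl
  refine ⟨⟨((posSemidef_tensor hE.1 hM.1).add (posSemidef_tensor hM.1 hE.1)).smul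
    (by positivity), ?_⟩, hsnd, hfst⟩
  rw [← trace_traceSnd, hsnd, (isState_exampleState hd).2]

/-- `T_B(ρ) = (1 + d F) / (2 d²)` has absolute value `(d + F) / (2 d²)`, since `F = ± 1` on the
symmetric and antisymmetric subspaces and `d ≥ 1`. -/
theorem cfcAbs_partialTranspose_exampleState (hd : 1 ≤ d) :
    CFC.abs (partialTranspose (Fin d) (Fin d) (exampleState d))
      = (1 / (2 * (d : ℂ) ^ 2)) • ((d : ℂ) • (1 : BiOp (Fin d) (Fin d)) + swapOp d) := by
  have hd' : (d : ℂ) ≠ 0 := Nat.cast_ne_zero.2 (by omega)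
  have hF := isHermitian_swapOp d
  have hFF := swapOp_mul_swapOp d
  have hX : partialTranspose (Fin d) (Fin d) (exampleState d)
      = ((1 / (2 * (d : ℝ) ^ 2) : ℝ) : ℂ)
        • ((1 : BiOp (Fin d) (Fin d)) + ((d : ℝ) : ℂ) • swapOp d) := by
    rw [exampleState, map_add, map_smul, map_smul, partialTranspose_maxEntangled, maxMixed,
      map_smul, partialTranspose_one]
    push_cast
    match_scalars <;> field_simp
  apply cfcAbs_eq_of_posSemidef
  -- `d + F = (d - 1) + (1 + F)` is positive.
  · have h1 : (0 : ℂ) ≤ (((d : ℝ) - 1 : ℝ) : ℂ) :=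
      Complex.zero_le_real.2 (sub_nonneg.2 (by exact_mod_cast hd))
    have h := (Matrix.PosSemidef.one (n := Fin d × Fin d) (R := ℂ)).smul h1
    have h2 := (h.add (posSemidef_one_add_of_involution hF hFF)).smul
      (show (0 : ℂ) ≤ 1 / (2 * (d : ℂ) ^ 2) by positivity)
    convert h2 using 2
    push_cast
    module
  · rw [hX, Matrix.conjTranspose_smul, Matrix.conjTranspose_add, Matrix.conjTranspose_smul, hF.eq,
      Matrix.conjTranspose_one]
    simp only [RCLike.star_def, Complex.conj_ofReal, Matrix.smul_mul, Matrix.mul_smul,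
      Matrix.add_mul, Matrix.mul_add, Matrix.one_mul, Matrix.mul_one, hFF]
    push_cast
    module

/-- `T_B(μ) = (F₁ + F₂) / (2 d³)` has absolute value `(1 + F₁ F₂) / (2 d³)`: where the signs of the
swaps `F₁`, `F₂` agree both `|F₁ + F₂|` and `1 + F₁ F₂` are `2`, elsewhere both vanish. -/
theorem cfcAbs_partialTranspose_exampleBroadcast (d : ℕ) :
    CFC.abs (partialTranspose (Fin d × Fin d) (Fin d × Fin d) (exampleBroadcast d))
      = (1 / (2 * (d : ℂ) ^ 3)) • (1 + tensor (swapOp d) (swapOp d)) := by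
  have hF := isHermitian_swapOp d
  have hFF := swapOp_mul_swapOp d
  have hS : (tensor (swapOp d) (swapOp d)).IsHermitian := isHermitian_tensor hF hF
  have hSS : tensor (swapOp d) (swapOp d) * tensor (swapOp d) (swapOp d) = 1 := by
    rw [tensor_mul, hFF, tensor_one]
  have hX : partialTranspose (Fin d × Fin d) (Fin d × Fin d) (exampleBroadcast d)
      = ((1 / (2 * (d : ℝ) ^ 3) : ℝ) : ℂ) • (tensor (swapOp d) 1 + tensor 1 (swapOp d)) := by
    rw [exampleBroadcast, map_smul, map_add, partialTranspose_tensor, partialTranspose_tensor,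
      partialTranspose_maxEntangled, maxMixed, map_smul, partialTranspose_one]
    simp only [tensor_smul_left, tensor_smul_right]
    push_cast
    match_scalars <;> field_simp
  have hH : (tensor (swapOp d) 1 + tensor 1 (swapOp d)).IsHermitian :=
    (isHermitian_tensor hF Matrix.isHermitian_one).add
      (isHermitian_tensor Matrix.isHermitian_one hF)
  apply cfcAbs_eq_of_posSemidef
  · exact (posSemidef_one_add_of_involution hS hSS).smul (by positivity)
  · rw [hX, Matrix.conjTranspose_smul, hH.eq]
    simp only [RCLike.star_def, Complex.conj_ofReal, Matrix.smul_mul, Matrix.mul_smul,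
      Matrix.add_mul, Matrix.mul_add, Matrix.one_mul, Matrix.mul_one, hSS, tensor_mul, hFF,
      tensor_one]
    push_cast
    module

theorem hasPositiveBinegativity_exampleState (hd : 1 ≤ d) :
    HasPositiveBinegativity (exampleState d) := by
  rw [HasPositiveBinegativity, cfcAbs_partialTranspose_exampleState hd, map_smul, map_add,
    map_smul, partialTranspose_one, partialTranspose_swapOp hd]
  exact ((Matrix.PosSemidef.one.smul (by positivity)).add
    ((posSemidef_maxEntangled d).smul (by positivity))).smul (by positivity)

theorem hasPositiveBinegativity_exampleBroadcast (hd : 1 ≤ d) :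
    HasPositiveBinegativity (exampleBroadcast d) := by
  rw [HasPositiveBinegativity, cfcAbs_partialTranspose_exampleBroadcast, map_smul, map_add,
    partialTranspose_one, partialTranspose_tensor, partialTranspose_swapOp hd, tensor_smul_left,
    tensor_smul_right]
  have h := posSemidef_maxEntangled d
  exact (Matrix.PosSemidef.one.add (((posSemidef_tensor h h).smul (by positivity)).smul
    (by positivity))).smul (by positivity)

theorem traceNorm_partialTranspose_exampleState (hd : 1 ≤ d) :
    traceNorm (partialTranspose (Fin d) (Fin d) (exampleState d))
      = ((d : ℝ) ^ 2 + 1) / d / 2 := by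
  have hd' : (d : ℂ) ≠ 0 := Nat.cast_ne_zero.2 (by omega)
  rw [← Complex.ofReal_inj, coe_traceNorm, cfcAbs_partialTranspose_exampleState hd,
    Matrix.trace_smul, Matrix.trace_add, Matrix.trace_smul, trace_swapOp, Matrix.trace_one]
  simp only [Fintype.card_prod, Fintype.card_fin, smul_eq_mul]
  push_cast
  field_simp

theorem traceNorm_partialTranspose_exampleBroadcast (hd : 1 ≤ d) :
    traceNorm (partialTranspose (Fin d × Fin d) (Fin d × Fin d) (exampleBroadcast d))
      = ((d : ℝ) ^ 2 + 1) / d / 2 := by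
  have hd' : (d : ℂ) ≠ 0 := Nat.cast_ne_zero.2 (by omega)
  rw [← Complex.ofReal_inj, coe_traceNorm, cfcAbs_partialTranspose_exampleBroadcast,
    Matrix.trace_smul, Matrix.trace_add, ← trace_traceSnd (tensor _ _), traceSnd_tensor,
    Matrix.trace_smul, trace_swapOp, Matrix.trace_one]
  simp only [Fintype.card_prod, Fintype.card_fin, smul_eq_mul]
  push_cast
  field_simp

theorem logb_half_eq (hd : 1 ≤ d) :
    Real.logb 2 (((d : ℝ) ^ 2 + 1) / d / 2) = Real.logb 2 (((d : ℝ) ^ 2 + 1) / d) - 1 := by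
  have hd' : (0 : ℝ) < d := by exact_mod_cast hd
  rw [Real.logb_div (by positivity) two_ne_zero, Real.logb_self_eq_one one_lt_two]

theorem logNegativity_exampleState_pos (hd : 2 ≤ d) : 0 < logNegativity (exampleState d) := by
  have hd' : (2 : ℝ) ≤ d := by exact_mod_cast hd
  rw [logNegativity, traceNorm_partialTranspose_exampleState (one_le_two.trans hd)]
  refine Real.logb_pos one_lt_two ?_
  rw [div_div, one_lt_div (by positivity)]
  nlinarith

end Example

end PPTEntanglement

theorem mainTheorem4 (d : ℕ) (hd : 1 ≤ d) :
    PPTEntanglement.IsState (PPTEntanglement.exampleState d) ∧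
    PPTEntanglement.IsTwoCopyBroadcast
      (PPTEntanglement.exampleBroadcast d) (PPTEntanglement.exampleState d) ∧
    PPTEntanglement.HasPositiveBinegativity (PPTEntanglement.exampleState d) ∧
    PPTEntanglement.HasPositiveBinegativity (PPTEntanglement.exampleBroadcast d) ∧
    PPTEntanglement.logNegativity (PPTEntanglement.exampleState d)
      = Real.logb 2 (((d : ℝ) ^ 2 + 1) / d) - 1 ∧
    PPTEntanglement.logNegativity (PPTEntanglement.exampleBroadcast d)
      = Real.logb 2 (((d : ℝ) ^ 2 + 1) / d) - 1 ∧
    PPTEntanglement.exactCost (PPTEntanglement.exampleState d)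
      = (PPTEntanglement.logNegativity (PPTEntanglement.exampleState d) : EReal) ∧
    PPTEntanglement.exactCost (PPTEntanglement.exampleBroadcast d)
      = (PPTEntanglement.logNegativity (PPTEntanglement.exampleBroadcast d) : EReal) ∧
    PPTEntanglement.catalyticExactCost (PPTEntanglement.exampleState d)
      ≤ PPTEntanglement.exactCost (PPTEntanglement.exampleBroadcast d) / 2 ∧
    PPTEntanglement.catalyticExactCost (PPTEntanglement.exampleState d)
      ≤ PPTEntanglement.exactCost (PPTEntanglement.exampleState d) / 2 ∧
    (2 ≤ d →
      PPTEntanglement.exactCost (PPTEntanglement.exampleBroadcast d) / 2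
        < PPTEntanglement.exactCost (PPTEntanglement.exampleState d)) := by
  have hρ := PPTEntanglement.isState_exampleState hd
  have hμ := PPTEntanglement.isTwoCopyBroadcast_exampleBroadcast hd
  have hρbi := PPTEntanglement.hasPositiveBinegativity_exampleState hd
  have hμbi := PPTEntanglement.hasPositiveBinegativity_exampleBroadcast hd
  have hLρ : PPTEntanglement.logNegativity (PPTEntanglement.exampleState d)
      = Real.logb 2 (((d : ℝ) ^ 2 + 1) / d) - 1 := by
    rw [PPTEntanglement.logNegativity, PPTEntanglement.traceNorm_partialTranspose_exampleState hd,
      PPTEntanglement.logb_half_eq hd]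
  have hLμ : PPTEntanglement.logNegativity (PPTEntanglement.exampleBroadcast d)
      = Real.logb 2 (((d : ℝ) ^ 2 + 1) / d) - 1 := by
    rw [PPTEntanglement.logNegativity,
      PPTEntanglement.traceNorm_partialTranspose_exampleBroadcast hd,
      PPTEntanglement.logb_half_eq hd]
  have hcρ := PPTEntanglement.exactCost_eq_logNegativity hρ hρbi
  have hcμ := PPTEntanglement.exactCost_eq_logNegativity hμ.1 hμbi
  have hcc := hμ.catalyticExactCost_le hρ hμbi
  have hcost : PPTEntanglement.exactCost (PPTEntanglement.exampleBroadcast d)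
      = PPTEntanglement.exactCost (PPTEntanglement.exampleState d) := by
    rw [hcρ, hcμ, hLρ, hLμ]
  refine ⟨hρ, hμ, hρbi, hμbi, hLρ, hLμ, hcρ, hcμ, hcc, hcost ▸ hcc, fun hd2 => ?_⟩
  have hpos := PPTEntanglement.logNegativity_exampleState_pos hd2
  have h2 : ((2 : ℝ) : EReal) = 2 := rfl
  rw [hcost, hcρ, ← h2, ← EReal.coe_div, EReal.coe_lt_coe_iff]
  linarith
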